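/- Let $\mathbb N^{\mathbb Z}$ carry the product topology ($\mathbb N$ discrete) and let $\sigma(x)_i=x_{i+1}$. A \emph{subshift} is a compact set $X\subset\mathbb N^{\mathbb Z}$ with $\sigma(X)=X$ (so only finitely many letters occur in $X$). Let $X$ be a countable subshift that contains at most $3$ subshifts, where $\emptyset$ and $X$ itself are counted. Then: (1) If $X\neq\emptyset$, there are finite words $u,v$, with $u$ nonempty, such that $X$ is the orbit closure $\overline{\{\sigma^k(x) : k\in\mathbb Z\}}$ of the bi-infinite sequence $x={}^\infty u\,v\,u^\infty=\cdots uuu\,v\,uuu\cdots$. (2) $X$ is decidable, that is, its model-checking problem for Muller automata is decidable: there is an algorithm that, given a Muller automaton describing a language $Y$ of infinite words, decides whether $X\cap Y\neq\emptyset$. This holds both for Muller automata on one-sided infinite words, where $Y$ is the set of $x\in\mathbb N^{\mathbb Z}$ such that some run on $x_0x_1x_2\cdots$ from an initial state has its set of infinitely often visited states in the given table, and for Muller automata on bi-infinite words, where $Y$ is the set of $x\in\mathbb N^{\mathbb Z}$ such that some bi-infinite run on $x$ has its pair (states visited infinitely often towards $-\infty$, states visited infinitely often towards $+\infty$) in the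 given table. -/

import Mathlib

open Filter

/-- The shift map `σ(x)_i = x_{i+1}` on bi-infinite sequences is
`SymbolicDynamics.FullShift.shift 1`, and `σ^k` is `SymbolicDynamics.FullShift.shift k`.
A subshift is a compact set `X ⊆ ℕ^ℤ` (`ℕ` discrete, product topology) with `σ(X) = X`.
Compactness forces the set of letters occurring in `X` to be finite. -/
def IsSubshift (X : Set (ℤ → ℕ)) : Prop :=
  IsCompact X ∧ SymbolicDynamics.FullShift.shift (1 : ℤ) '' X = X

/-- The number of subshifts contained in `X`; the empty subshift and `X` itself are counted. -/
noncomputable def subsystemCount (X : Set (ℤ → ℕ)) : ℕ∞ :=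
  {Y : Set (ℤ → ℕ) | IsSubshift Y ∧ Y ⊆ X}.encard

/-- The orbit closure of a bi-infinite sequence. -/
def orbitClosure (x : ℤ → ℕ) : Set (ℤ → ℕ) :=
  closure (Set.range fun k : ℤ => SymbolicDynamics.FullShift.shift k x)

/-- The bi-infinite sequence `… u u u . v w w w …`, with `v` starting at coordinate `0`,
for nonempty `u` and `w`. -/
def biPeriodicPoint (u v w : List ℕ) (i : ℤ) : ℕ :=
  if i < 0 then u.getD (i % (u.length : ℤ)).toNat 0
  else if i < (v.length : ℤ) then v.getD i.toNat 0
  else w.getD ((i - (v.length : ℤ)) % (w.length : ℤ)).toNat 0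

/-- A (nondeterministic) Muller automaton on one-sided infinite words. States and letters are
natural numbers; only finitely many occur in the list of transitions
`(source, letter, target)`. The lists in `table` are read as sets of states. -/
structure MullerAutomaton where
  initial : List ℕ
  trans : List (ℕ × ℕ × ℕ)
  table : List (List ℕ)

namespace MullerAutomaton

/-- `M` accepts `w` if some run on `w` from an initial state has as its set of states visited
infinitely often one of the sets of the table. -/
def Accepts (M : MullerAutomaton) (w : ℕ → ℕ) : Prop :=
  ∃ r : ℕ → ℕ, r 0 ∈ M.initial ∧ (∀ i, (r i, w i, r (i + 1)) ∈ M.trans) ∧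
    ∃ F ∈ M.table, {q | ∃ᶠ i in atTop, r i = q} = {q | q ∈ F}

/-- The data of an automaton as a tuple of lists. -/
def equivProd : MullerAutomaton ≃ List ℕ × List (ℕ × ℕ × ℕ) × List (List ℕ) where
  toFun M := (M.initial, M.trans, M.table)
  invFun p := ⟨p.1, p.2.1, p.2.2⟩
  left_inv _ := rfl
  right_inv _ := rfl

instance : Primcodable MullerAutomaton :=
  Primcodable.ofEquiv _ equivProd

end MullerAutomaton

/-- A (nondeterministic) Muller automaton on bi-infinite words. A pair `(L, R)` of the table
prescribes the set `L` of states visited infinitely often towards `-∞` and the set `R` of states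
visited infinitely often towards `+∞`. -/
structure BiMullerAutomaton where
  trans : List (ℕ × ℕ × ℕ)
  table : List (List ℕ × List ℕ)

namespace BiMullerAutomaton

/-- `M` accepts `x` if some bi-infinite run on `x` has as its pair of left and right limit sets
of states one of the pairs of the table. -/
def Accepts (M : BiMullerAutomaton) (x : ℤ → ℕ) : Prop :=
  ∃ r : ℤ → ℕ, (∀ i, (r i, x i, r (i + 1)) ∈ M.trans) ∧
    ∃ F ∈ M.table, {q | ∃ᶠ i in atBot, r i = q} = {q | q ∈ F.1} ∧
      {q | ∃ᶠ i in atTop, r i = q} = {q | q ∈ F.2}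

/-- The data of an automaton as a pair of lists. -/
def equivProd : BiMullerAutomaton ≃ List (ℕ × ℕ × ℕ) × List (List ℕ × List ℕ) where
  toFun M := (M.trans, M.table)
  invFun p := ⟨p.1, p.2⟩
  left_inv _ := rfl
  right_inv _ := rfl

instance : Primcodable BiMullerAutomaton :=
  Primcodable.ofEquiv _ equivProd

end BiMullerAutomaton

/-- `X` is decidable: there is an algorithm that, given a Muller automaton, decides whether `X`
contains a point of the language it describes. This is required both for automata on one-sided
words, which read the right half `x_0 x_1 x_2 …` of a point `x`, and for automata on bi-infinite
words, which read all of `x`. -/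
def IsMullerDecidable (X : Set (ℤ → ℕ)) : Prop :=
  ComputablePred (fun M : MullerAutomaton => ∃ x ∈ X, M.Accepts fun n : ℕ => x (n : ℤ)) ∧
  ComputablePred (fun M : BiMullerAutomaton => ∃ x ∈ X, M.Accepts x)

/-! Structure. By Baire, a nonempty countable compact `X` has an isolated point `x`; its orbit is
relatively open, so removing it leaves a subshift `Z`. If `Z` is empty, `X` is a compact discrete
orbit, hence finite, and `x` is periodic. Otherwise the bound on subshifts makes `Z` the only
nonempty proper one, and the same argument shows that `Z` is a single periodic orbit, that of some
`z`. Only finitely many points of `X` lie outside a given open neighbourhood of `Z`, so all but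
finitely many windows of `x` look like `z`. Both tails of `x` therefore repeat one word `u`, and `v`
fills the gap: see `IsSubshift.exists_eq_orbitClosure`.

Decidability. Such an `X` is the set of labels of bi-infinite paths in a finite graph, namely two
cycles labelled `u` joined by a path labelled `v` (`isPresentedBy_wordGraph`). Acceptance then asks
for infinite paths with prescribed limit sets in the product of this graph with the automaton. By
`hasLimit_iff` this is a finite search for a reachable closed walk, and the search is primitive
recursive in the automaton. -/

/-! ### Computing reachability in finite graphs. -/

section Reachability

variable {α : Type*}

/-- One step of breadth-first search in the graph with edge list `E`. -/
def expand [DecidableEq α] (E : List (α × α)) (S : List α) : List α :=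
  S ++ (E.filter fun e => e.1 ∈ S).map Prod.snd

/-- The vertices reachable from `a` in the graph with edge list `E`. -/
def reachList [DecidableEq α] (E : List (α × α)) (a : α) : List α :=
  (expand E)^[E.length + 1] [a]

theorem mem_expand [DecidableEq α] {E : List (α × α)} {S : List α} {b : α} :
    b ∈ expand E S ↔ b ∈ S ∨ ∃ a ∈ S, (a, b) ∈ E := by
  simp only [expand, List.mem_append, List.mem_map, List.mem_filter, decide_eq_true_eq]
  constructor
  · rintro (h | ⟨⟨a, c⟩, ⟨h1, h2⟩, rfl⟩)
    · exact Or.inl h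
    · exact Or.inr ⟨a, h2, h1⟩
  · rintro (h | ⟨a, h1, h2⟩)
    · exact Or.inl h
    · exact Or.inr ⟨(a, b), ⟨h2, h1⟩, rfl⟩

theorem iterate_expand_subset [DecidableEq α] (E : List (α × α)) (a : α) (n : ℕ) :
    ((expand E)^[n] [a]).toFinset ⊆ insert a (E.map Prod.snd).toFinset := by
  induction n with
  | zero => simp
  | succ n ih =>
    intro b hb
    rw [Function.iterate_succ_apply', List.mem_toFinset, mem_expand] at hb
    rcases hb with hb | ⟨c, -, hc⟩
    · exact ih (List.mem_toFinset.2 hb)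
    · simp only [Finset.mem_insert, List.mem_toFinset, List.mem_map]
      exact Or.inr ⟨_, hc, rfl⟩

/-- Each strict growth step adds a vertex, and only `a` and the edge targets are available, at most
`E.length + 1` vertices in all. -/
theorem exists_expand_stable [DecidableEq α] (E : List (α × α)) (a : α) :
    ∃ n ≤ E.length, ((expand E)^[n + 1] [a]).toFinset = ((expand E)^[n] [a]).toFinset := by
  by_contra! h
  have key : ∀ n ≤ E.length + 1, n + 1 ≤ ((expand E)^[n] [a]).toFinset.card := by
    intro n
    induction n with
    | zero => simp
    | succ n ih =>
      intro hn
      refine Nat.succ_le_of_lt ((ih (by omega)).trans_lt (Finset.card_lt_card ?_))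
      refine Finset.ssubset_iff_subset_ne.2 ⟨fun b hb => ?_, (h n (by omega)).symm⟩
      rw [List.mem_toFinset] at hb ⊢
      rw [Function.iterate_succ_apply', mem_expand]
      exact Or.inl hb
  have h1 := key _ le_rfl
  have h2 := Finset.card_le_card (iterate_expand_subset E a (E.length + 1))
  have h3 := Finset.card_insert_le a (E.map Prod.snd).toFinset
  have h4 := List.toFinset_card_le (E.map Prod.snd)
  rw [List.length_map] at h4
  omega

theorem mem_reachList [DecidableEq α] {E : List (α × α)} {a b : α} :
    b ∈ reachList E a ↔ Relation.ReflTransGen (fun x y => (x, y) ∈ E) a b := by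
  constructor
  · have key : ∀ n b, b ∈ (expand E)^[n] [a] →
        Relation.ReflTransGen (fun x y => (x, y) ∈ E) a b := by
      intro n
      induction n with
      | zero =>
        intro b hb
        obtain rfl : b = a := by simpa using hb
        exact .refl
      | succ n ih =>
        intro b hb
        rw [Function.iterate_succ_apply', mem_expand] at hb
        rcases hb with hb | ⟨c, hc, hcb⟩
        · exact ih b hb
        · exact (ih c hc).tail hcb
    exact key _ b
  · obtain ⟨n, hn, hs⟩ := exists_expand_stable E a
    have mono : ∀ m k b, b ∈ (expand E)^[m] [a] → b ∈ (expand E)^[m + k] [a] := by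
      intro m k b hb
      induction k with
      | zero => exact hb
      | succ k ih =>
        rw [← add_assoc, Function.iterate_succ_apply', mem_expand]
        exact Or.inl ih
    intro h
    obtain ⟨k, hk⟩ := Nat.exists_eq_add_of_le (hn.trans (Nat.le_succ _))
    rw [reachList, ← Nat.succ_eq_add_one, hk]
    apply mono
    induction h with
    | refl => simpa using mono 0 n a (by simp)
    | tail _ hbc ih =>
      -- The stable stage `n` agrees with stage `n + 1`, so it is closed under following an edge.
      rw [← List.mem_toFinset, ← hs, List.mem_toFinset, Function.iterate_succ_apply', mem_expand]
      exact Or.inr ⟨_, ih, hbc⟩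

theorem primrecRel_mem_list {α : Type*} [Primcodable α] :
    PrimrecRel fun (a : α) (l : List α) => a ∈ l := by
  classical
  exact (PrimrecRel.exists_mem_list (Primrec.eq (α := α))).swap.of_eq
    fun a l => by simp [Function.swap]

theorem primrec_reachList [Primcodable α] [DecidableEq α] :
    Primrec fun p : List (α × α) × α => reachList p.1 p.2 := by
  have hfilter : Primrec₂ fun (E : List (α × α)) (S : List α) => E.filter fun e => e.1 ∈ S :=
    PrimrecRel.listFilter (R := fun (e : α × α) (S : List α) => e.1 ∈ S)
      (primrecRel_mem_list.comp₂ (Primrec.fst.comp Primrec.fst).to₂ Primrec.snd.to₂)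
  have hexp : Primrec₂ fun (E : List (α × α)) (S : List α) => expand E S :=
    Primrec.list_append.comp Primrec.snd
      (Primrec.list_map hfilter (Primrec.snd.comp Primrec.snd).to₂)
  exact Primrec.nat_iterate (Primrec.succ.comp (Primrec.list_length.comp Primrec.fst))
    (Primrec.list_cons.comp Primrec.snd (Primrec.const []))
    (hexp.comp (Primrec.fst.comp Primrec.fst) Primrec.snd).to₂

end Reachability

/-! ### Concatenating and repeating walks. -/

section Walks

variable {α : Type*}

/-- `w` is a walk of length `n` from `a` to `b` for the relation `R`. -/
def IsWalk (R : α → α → Prop) (n : ℕ) (w : ℕ → α) (a b : α) : Prop :=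
  w 0 = a ∧ w n = b ∧ ∀ i < n, R (w i) (w (i + 1))

/-- Concatenation of a walk of length `n` with another sequence. -/
def concatAt (n : ℕ) (w w' : ℕ → α) (i : ℕ) : α := if i < n then w i else w' (i - n)

theorem concatAt_add (n : ℕ) (w w' : ℕ → α) (i : ℕ) : concatAt n w w' (n + i) = w' i := by
  simp [concatAt]

theorem concatAt_of_le {n : ℕ} {w w' : ℕ → α} (h : w n = w' 0) {i : ℕ} (hi : i ≤ n) :
    concatAt n w w' i = w i := by
  rcases hi.lt_or_eq with hi | rfl
  · simp [concatAt, hi]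
  · simp [concatAt, h]

theorem concatAt_step {R : α → α → Prop} {n : ℕ} {w w' : ℕ → α} (h : w n = w' 0) {i : ℕ}
    (h1 : i < n → R (w i) (w (i + 1))) (h2 : n ≤ i → R (w' (i - n)) (w' (i - n + 1))) :
    R (concatAt n w w' i) (concatAt n w w' (i + 1)) := by
  rcases lt_or_ge i n with hi | hi
  · rw [concatAt_of_le h hi.le, concatAt_of_le h hi]
    exact h1 hi
  · obtain ⟨j, rfl⟩ := Nat.exists_eq_add_of_le hi
    rw [add_assoc, concatAt_add, concatAt_add]
    simpa using h2 hi

theorem IsWalk.concat {R : α → α → Prop} {n m : ℕ} {w w' : ℕ → α} {a b c : α}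
    (h : IsWalk R n w a b) (h' : IsWalk R m w' b c) :
    IsWalk R (n + m) (concatAt n w w') a c := by
  have e : w n = w' 0 := h.2.1.trans h'.1.symm
  refine ⟨(concatAt_of_le e (Nat.zero_le _)).trans h.1, (concatAt_add ..).trans h'.2.1,
    fun i hi => concatAt_step e (h.2.2 i) fun hn => h'.2.2 _ (by omega)⟩

theorem exists_isWalk_of_reflTransGen {R : α → α → Prop} {a b : α}
    (h : Relation.ReflTransGen R a b) : ∃ n w, IsWalk R n w a b := by
  induction h with
  | refl => exact ⟨0, fun _ => a, rfl, rfl, by simp⟩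
  | @tail b c _ hbc ih =>
    obtain ⟨n, w, hw⟩ := ih
    exact ⟨n + 1, _, hw.concat (m := 1) (w' := fun i => if i = 0 then b else c)
      ⟨by simp, by simp, fun i hi => by simpa [Nat.lt_one_iff.1 hi] using hbc⟩⟩

theorem reflTransGen_of_path {R : α → α → Prop} {r : ℕ → α} {N : ℕ}
    (h : ∀ i ≥ N, R (r i) (r (i + 1))) {i j : ℕ} (hi : N ≤ i) (hij : i ≤ j) :
    Relation.ReflTransGen R (r i) (r j) := by
  induction j, hij using Nat.le_induction with
  | base => exact .refl
  | succ j hj ih => exact ih.tail (h j (hi.trans hj))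

/-- Closed walks through the values in a finite list can be concatenated. -/
theorem exists_closed_walk {R : α → α → Prop} {f : α → ℕ} {c : α} (F : List ℕ) (hF : F ≠ [])
    (h : ∀ q ∈ F, ∃ a b, f a = q ∧ R a b ∧ Relation.ReflTransGen R c a ∧
      Relation.ReflTransGen R b c) :
    ∃ n w, 0 < n ∧ IsWalk R n w c c ∧ ∀ q ∈ F, ∃ i < n, f (w i) = q := by
  have single : ∀ q ∈ F, ∃ n w, 0 < n ∧ IsWalk R n w c c ∧ ∃ i < n, f (w i) = q := by
    intro q hq
    obtain ⟨a, b, hf, hab, hca, hbc⟩ := h q hq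
    obtain ⟨n, w, hw⟩ := exists_isWalk_of_reflTransGen hca
    obtain ⟨m, w'', hw''⟩ := exists_isWalk_of_reflTransGen hbc
    have h1 : IsWalk R 1 (fun i => if i = 0 then a else b) a b :=
      ⟨by simp, by simp, fun i hi => by simpa [Nat.lt_one_iff.1 hi] using hab⟩
    have h2 := h1.concat hw''
    have e : w n = concatAt 1 (fun i => if i = 0 then a else b) w'' 0 := hw.2.1.trans h2.1.symm
    refine ⟨_, _, ?_, hw.concat h2, n, ?_, ?_⟩
    · omega
    · omega
    · rw [concatAt_of_le e le_rfl, hw.2.1, hf]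
  clear h
  induction F with
  | nil => exact absurd rfl hF
  | cons q F ih =>
    obtain ⟨n, w, hn, hw, i, hi, hq⟩ := single q (by simp)
    by_cases hF' : F = []
    · subst hF'
      exact ⟨n, w, hn, hw, by simpa using ⟨i, hi, hq⟩⟩
    obtain ⟨m, w', hm, hw', hF⟩ := ih hF' fun q hq => single q (by simp [hq])
    refine ⟨n + m, concatAt n w w', by omega, hw.concat hw', ?_⟩
    simp only [List.mem_cons, forall_eq_or_imp]
    refine ⟨⟨i, by omega, ?_⟩, fun p hp => ?_⟩
    · rw [concatAt_of_le (hw.2.1.trans hw'.1.symm) hi.le, hq]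
    · obtain ⟨j, hj, hp⟩ := hF p hp
      exact ⟨n + j, by omega, by rw [concatAt_add, hp]⟩

/-- A closed walk, repeated forever. -/
theorem IsWalk.periodic_step {R : α → α → Prop} {n : ℕ} {w : ℕ → α} {c : α} (hn : 0 < n)
    (h : IsWalk R n w c c) (i : ℕ) : R (w (i % n)) (w ((i + 1) % n)) := by
  have h1 := h.2.2 _ (Nat.mod_lt i hn)
  rcases (Nat.succ_le_of_lt (Nat.mod_lt i hn)).lt_or_eq with h2 | h2
  · rwa [Nat.add_mod, Nat.mod_eq_of_lt (a := 1) (by omega), Nat.mod_eq_of_lt h2]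
  · have h3 : (i + 1) % n = 0 := by
      rw [← Nat.mod_add_mod, ← Nat.succ_eq_add_one, h2, Nat.mod_self]
    rw [h3, h.1]
    rw [← Nat.succ_eq_add_one, h2, h.2.1] at h1
    exact h1

end Walks

/-! ### Infinite paths with a prescribed limit set. -/

section LimitSets

/-- The edges between vertices whose first component lies in `F`. -/
def restrictEdges (F : List ℕ) (E : List ((ℕ × ℕ) × (ℕ × ℕ))) : List ((ℕ × ℕ) × (ℕ × ℕ)) :=
  E.filter fun e => e.1.1 ∈ F ∧ e.2.1 ∈ F

/-- There is an infinite path from `s` along which exactly the elements of `F` occur infinitely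
often as first components. -/
def HasLimit (E : List ((ℕ × ℕ) × (ℕ × ℕ))) (F : List ℕ) (s : ℕ × ℕ) : Prop :=
  ∃ r : ℕ → ℕ × ℕ, r 0 = s ∧ (∀ i, (r i, r (i + 1)) ∈ E) ∧
    {q | ∃ᶠ i in atTop, (r i).1 = q} = {q | q ∈ F}

/-- Some closed walk at `c` visits exactly the elements of `F` as first components. -/
def LoopsAt (E : List ((ℕ × ℕ) × (ℕ × ℕ))) (F : List ℕ) (c : ℕ × ℕ) : Prop :=
  F ≠ [] ∧ ∀ q ∈ F, ∃ e ∈ restrictEdges F E, e.1.1 = q ∧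
    e.1 ∈ reachList (restrictEdges F E) c ∧ c ∈ reachList (restrictEdges F E) e.2

/-- A lasso: walk from `s` to `c`, then repeat a closed walk that stays over `F` and meets every
element of `F`. -/
theorem LoopsAt.hasLimit {E : List ((ℕ × ℕ) × (ℕ × ℕ))} {F : List ℕ} {s c : ℕ × ℕ}
    (hs : c ∈ reachList E s) (hc : LoopsAt E F c) : HasLimit E F s := by
  obtain ⟨hF, hc⟩ := hc
  simp only [mem_reachList] at hs hc
  obtain ⟨n, w, hn, hw, hwF⟩ := exists_closed_walk (f := Prod.fst)
    (R := fun x y => (x, y) ∈ restrictEdges F E) (c := c) F hF fun q hq => by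
      obtain ⟨e, he, h1, h2, h3⟩ := hc q hq
      exact ⟨e.1, e.2, h1, he, h2, h3⟩
  obtain ⟨m, w', hw'⟩ := exists_isWalk_of_reflTransGen hs
  obtain ⟨p, hp⟩ : ∃ p : ℕ → ℕ × ℕ, ∀ i, p i = w (i % n) := ⟨_, fun _ => rfl⟩
  have e : w' m = p 0 := by simp [hp, hw'.2.1, hw.1]
  have hres : ∀ i, (w (i % n), w ((i + 1) % n)) ∈ restrictEdges F E := hw.periodic_step hn
  simp only [← hp, restrictEdges, List.mem_filter, decide_eq_true_eq] at hres
  refine ⟨concatAt m w' p, ?_, fun i => ?_, ?_⟩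
  · rw [concatAt_of_le e (Nat.zero_le _), hw'.1]
  · exact concatAt_step (R := fun x y => (x, y) ∈ E) e (hw'.2.2 i) fun _ => (hres _).1
  · ext q
    simp only [Set.mem_ofPred_eq]
    constructor
    · intro h
      obtain ⟨i, hi, rfl⟩ := frequently_atTop.1 h m
      obtain ⟨j, rfl⟩ := Nat.exists_eq_add_of_le hi
      rw [concatAt_add]
      exact (hres j).2.1
    · intro hq
      obtain ⟨i, hi, rfl⟩ := hwF q hq
      -- The visit to `q` during round `N` of the loop.
      refine frequently_atTop.2 fun N => ⟨m + (i + n * N), ?_, ?_⟩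
      · nlinarith
      · rw [concatAt_add, hp, Nat.add_mul_mod_self_left, Nat.mod_eq_of_lt hi]

/-- With finitely many vertices, the path eventually stays over `F` and some vertex `c` recurs
forever. Each element of `F` is met between two late visits to `c`. -/
theorem HasLimit.exists_loopsAt {E : List ((ℕ × ℕ) × (ℕ × ℕ))} {F : List ℕ} {s : ℕ × ℕ}
    (h : HasLimit E F s) : ∃ e ∈ E, e.1 ∈ reachList E s ∧ LoopsAt E F e.1 := by
  obtain ⟨r, rfl, hr, hF⟩ := h
  have hF' : ∀ q, (∃ᶠ i in atTop, (r i).1 = q) ↔ q ∈ F := fun q => by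
    simpa using congrArg (q ∈ ·) hF
  have hfin : (Set.range r).Finite :=
    (List.finite_toSet (E.map Prod.fst)).subset (by
      rintro _ ⟨i, rfl⟩
      exact List.mem_map.2 ⟨_, hr i, rfl⟩)
  have hev : ∀ᶠ i in atTop, (r i).1 ∈ F := by
    have : ∀ᶠ i in atTop, ∀ a ∈ Set.range r, a.1 ∉ F → r i ≠ a := by
      refine (eventually_all_finite hfin).2 fun a _ => ?_
      by_cases ha : a.1 ∈ F
      · simp [ha]
      · have := mt (hF' a.1).1 ha
        rw [not_frequently] at this
        filter_upwards [this] with i hi _ hia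
        exact hi (by rw [hia])
    filter_upwards [this] with i hi
    by_contra hn
    exact hi _ ⟨i, rfl⟩ hn rfl
  obtain ⟨N, hN⟩ := eventually_atTop.1 hev
  obtain ⟨c, hc⟩ : ∃ c, ∃ᶠ i in atTop, r i = c := by
    have : ∃ᶠ i in (atTop : Filter ℕ), ∃ a ∈ Set.range r, r i = a :=
      Frequently.of_forall fun i => ⟨_, ⟨i, rfl⟩, rfl⟩
    by_contra! hcon
    refine this ?_
    have := (eventually_all_finite hfin).2
      fun a (_ : a ∈ Set.range r) => hcon a
    filter_upwards [this] with i hi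
    rintro ⟨a, ha, h⟩
    exact hi a ha h
  have hstep : ∀ i ≥ N, (r i, r (i + 1)) ∈ restrictEdges F E := fun i hi => by
    simpa [restrictEdges] using ⟨hr i, hN i hi, hN (i + 1) (by omega)⟩
  obtain ⟨t, ht, rfl⟩ := frequently_atTop.1 hc N
  refine ⟨_, hr t, ?_, ?_, fun q hq => ?_⟩
  · exact mem_reachList.2 (reflTransGen_of_path (N := 0) (fun i _ => hr i) le_rfl (Nat.zero_le t))
  · exact List.ne_nil_of_mem (hN t ht)
  · obtain ⟨i, hi, hiq⟩ := frequently_atTop.1 ((hF' q).2 hq) t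
    obtain ⟨t', ht', htt⟩ := frequently_atTop.1 hc (i + 1)
    refine ⟨_, hstep i (ht.trans hi), hiq, mem_reachList.2 (reflTransGen_of_path hstep ht hi),
      mem_reachList.2 ?_⟩
    have := reflTransGen_of_path (R := fun x y => (x, y) ∈ restrictEdges F E) hstep
      (i := i + 1) (by omega) ht'
    rwa [htt] at this

/-- Replaces a quantifier over infinite paths by quantifiers over finite lists, which are primitive
recursive. -/
theorem hasLimit_iff {E : List ((ℕ × ℕ) × (ℕ × ℕ))} {F : List ℕ} {s : ℕ × ℕ} :
    HasLimit E F s ↔ ∃ e ∈ E, e.1 ∈ reachList E s ∧ LoopsAt E F e.1 :=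
  ⟨HasLimit.exists_loopsAt, fun ⟨_, _, h1, h2⟩ => h2.hasLimit h1⟩

end LimitSets

/-! ### Primitive recursiveness of the search. -/

section Primrec

theorem primrecPred_mem_reachList {α β : Type*} [Primcodable α] [Primcodable β] [DecidableEq α]
    {E : β → List (α × α)} {a b : β → α} (hE : Primrec E) (ha : Primrec a) (hb : Primrec b) :
    PrimrecPred fun x => b x ∈ reachList (E x) (a x) :=
  primrecRel_mem_list.comp hb (primrec_reachList.comp (Primrec.pair hE ha))

theorem primrec_restrictEdges :
    Primrec₂ fun (F : List ℕ) (E : List ((ℕ × ℕ) × (ℕ × ℕ))) => restrictEdges F E :=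
  ((PrimrecRel.listFilter (R := fun (e : (ℕ × ℕ) × (ℕ × ℕ)) (F : List ℕ) => e.1.1 ∈ F ∧ e.2.1 ∈ F)
    (PrimrecPred.and
      (primrecRel_mem_list.comp (Primrec.fst.comp (Primrec.fst.comp Primrec.fst)) Primrec.snd)
      (primrecRel_mem_list.comp (Primrec.fst.comp (Primrec.snd.comp Primrec.fst)) Primrec.snd)))
    ).swap

theorem primrecRel_loopsAt :
    PrimrecRel fun (p : List ((ℕ × ℕ) × (ℕ × ℕ)) × List ℕ) (c : ℕ × ℕ) => LoopsAt p.1 p.2 c := by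
  have hE : Primrec fun p : List ((ℕ × ℕ) × (ℕ × ℕ)) × List ℕ => restrictEdges p.2 p.1 :=
    primrec_restrictEdges.comp Primrec.snd Primrec.fst
  -- `b` packs the state `q`, the base vertex `c` and the restricted edge list, since bounded
  -- quantification is applied to binary relations.
  have h1 : PrimrecRel fun (e : (ℕ × ℕ) × (ℕ × ℕ))
      (b : ℕ × (ℕ × ℕ) × List ((ℕ × ℕ) × (ℕ × ℕ))) =>
      e.1.1 = b.1 ∧ e.1 ∈ reachList b.2.2 b.2.1 ∧ b.2.1 ∈ reachList b.2.2 e.2 := by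
    have hE' : Primrec fun x : ((ℕ × ℕ) × (ℕ × ℕ)) × ℕ × (ℕ × ℕ) × List ((ℕ × ℕ) × (ℕ × ℕ)) =>
        x.2.2.2 := Primrec.snd.comp (Primrec.snd.comp Primrec.snd)
    have hc : Primrec fun x : ((ℕ × ℕ) × (ℕ × ℕ)) × ℕ × (ℕ × ℕ) × List ((ℕ × ℕ) × (ℕ × ℕ)) =>
        x.2.2.1 := Primrec.fst.comp (Primrec.snd.comp Primrec.snd)
    refine PrimrecPred.and ?_ (PrimrecPred.and ?_ ?_)
    · exact Primrec.eq.comp (Primrec.fst.comp (Primrec.fst.comp Primrec.fst))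
        (Primrec.fst.comp Primrec.snd)
    · exact primrecPred_mem_reachList hE' hc (Primrec.fst.comp Primrec.fst)
    · exact primrecPred_mem_reachList hE' (Primrec.snd.comp Primrec.fst) hc
  have hb : Primrec fun b : ℕ × (ℕ × ℕ) × List ((ℕ × ℕ) × (ℕ × ℕ)) => b.2.2 :=
    Primrec.snd.comp Primrec.snd
  have h2 : PrimrecRel fun (q : ℕ) (b : (ℕ × ℕ) × List ((ℕ × ℕ) × (ℕ × ℕ))) =>
      ∃ e ∈ b.2, e.1.1 = q ∧ e.1 ∈ reachList b.2 b.1 ∧ b.1 ∈ reachList b.2 e.2 :=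
    (h1.exists_mem_list.comp hb Primrec.id).primrecRel
  have hE' : Primrec fun x : (List ((ℕ × ℕ) × (ℕ × ℕ)) × List ℕ) × (ℕ × ℕ) =>
      restrictEdges x.1.2 x.1.1 := hE.comp Primrec.fst
  have hF : Primrec fun x : (List ((ℕ × ℕ) × (ℕ × ℕ)) × List ℕ) × (ℕ × ℕ) => x.1.2 :=
    Primrec.snd.comp Primrec.fst
  have h3 := h2.forall_mem_list.comp hF (Primrec.pair Primrec.snd hE')
  have h4 := (Primrec.eq.comp hF (Primrec.const [])).not
  exact (h4.and h3).of_eq fun x => Iff.rfl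

theorem primrecRel_hasLimit :
    PrimrecRel fun (p : List ((ℕ × ℕ) × (ℕ × ℕ)) × List ℕ) (s : ℕ × ℕ) => HasLimit p.1 p.2 s := by
  have h1 : PrimrecRel fun (e : (ℕ × ℕ) × (ℕ × ℕ))
      (b : (List ((ℕ × ℕ) × (ℕ × ℕ)) × List ℕ) × (ℕ × ℕ)) =>
      e.1 ∈ reachList b.1.1 b.2 ∧ LoopsAt b.1.1 b.1.2 e.1 := by
    refine PrimrecPred.and ?_ ?_
    · exact primrecPred_mem_reachList (Primrec.fst.comp (Primrec.fst.comp Primrec.snd))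
        (Primrec.snd.comp Primrec.snd) (Primrec.fst.comp Primrec.fst)
    · exact primrecRel_loopsAt.comp (Primrec.fst.comp Primrec.snd) (Primrec.fst.comp Primrec.fst)
  have h2 := h1.exists_mem_list.comp (Primrec.fst.comp Primrec.fst) Primrec.id
  exact h2.of_eq fun p => hasLimit_iff.symm

end Primrec

/-! ### Acceptance as a path problem in a product graph. -/

section Presentation

/-- The product of two labelled graphs given by lists of triples `(source, letter, target)`. -/
def productEdges (T H : List (ℕ × ℕ × ℕ)) : List ((ℕ × ℕ) × (ℕ × ℕ)) :=
  T.flatMap fun t => (H.filter fun h => h.2.1 = t.2.1).map fun h => ((t.1, h.1), (t.2.2, h.2.2))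

theorem mem_productEdges {T H : List (ℕ × ℕ × ℕ)} {e : (ℕ × ℕ) × (ℕ × ℕ)} :
    e ∈ productEdges T H ↔ ∃ a, (e.1.1, a, e.2.1) ∈ T ∧ (e.1.2, a, e.2.2) ∈ H := by
  simp only [productEdges, List.mem_flatMap, List.mem_map, List.mem_filter, decide_eq_true_eq]
  constructor
  · rintro ⟨⟨q, a, q'⟩, ht, ⟨h, b, h'⟩, ⟨hh, rfl⟩, rfl⟩
    exact ⟨_, ht, hh⟩
  · rintro ⟨a, ht, hh⟩
    exact ⟨_, ht, _, ⟨hh, rfl⟩, rfl⟩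

theorem primrec_productEdges (H : List (ℕ × ℕ × ℕ)) :
    Primrec fun T : List (ℕ × ℕ × ℕ) => productEdges T H := by
  have h1 : Primrec₂ fun (_ : List (ℕ × ℕ × ℕ)) (t : ℕ × ℕ × ℕ) =>
      H.filter fun h => h.2.1 = t.2.1 :=
    (PrimrecRel.listFilter (R := fun (h : ℕ × ℕ × ℕ) (t : ℕ × ℕ × ℕ) => h.2.1 = t.2.1)
      (Primrec.eq.comp (Primrec.fst.comp (Primrec.snd.comp Primrec.fst))
        (Primrec.fst.comp (Primrec.snd.comp Primrec.snd)))).comp (Primrec.const H) Primrec.snd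
  have ht : Primrec fun x : (List (ℕ × ℕ × ℕ) × ℕ × ℕ × ℕ) × ℕ × ℕ × ℕ => x.1.2 :=
    Primrec.snd.comp Primrec.fst
  have h2 : Primrec₂ fun (p : List (ℕ × ℕ × ℕ) × ℕ × ℕ × ℕ) (h : ℕ × ℕ × ℕ) =>
      ((p.2.1, h.1), (p.2.2.2, h.2.2)) :=
    Primrec.pair (Primrec.pair (Primrec.fst.comp ht) (Primrec.fst.comp Primrec.snd))
      (Primrec.pair (Primrec.snd.comp (Primrec.snd.comp ht))
        (Primrec.snd.comp (Primrec.snd.comp Primrec.snd)))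
  exact Primrec.list_flatMap Primrec.id (Primrec.list_map h1 h2)

/-- `X` is the set of labels of bi-infinite paths in the labelled graph `H`, in which every source
of an edge is also the target of an edge. -/
def IsPresentedBy (X : Set (ℤ → ℕ)) (H : List (ℕ × ℕ × ℕ)) : Prop :=
  (∀ x, x ∈ X ↔ ∃ h : ℤ → ℕ, ∀ i, (h i, x i, h (i + 1)) ∈ H) ∧ ∀ e ∈ H, ∃ e' ∈ H, e'.2.2 = e.1

/-- Choosing a preceding edge again and again extends a one-sided path to the left; this is the
purpose of the second clause of `IsPresentedBy`. -/
theorem IsPresentedBy.exists_extension {X : Set (ℤ → ℕ)} {H : List (ℕ × ℕ × ℕ)}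
    (hX : IsPresentedBy X H) {h w : ℕ → ℕ} (hw : ∀ i, (h i, w i, h (i + 1)) ∈ H) :
    ∃ x ∈ X, ∀ n : ℕ, x n = w n := by
  obtain ⟨hX, hpred⟩ := hX
  choose! g hg hg' using hpred
  let e : ℕ → ℕ × ℕ × ℕ := fun i => (h i, w i, h (i + 1))
  have hiter : ∀ n, g^[n] (e 0) ∈ H := by
    intro n
    induction n with
    | zero => exact hw 0
    | succ n ih => rw [Function.iterate_succ_apply']; exact hg _ ih
  let d : ℤ → ℕ × ℕ × ℕ := fun i => if 0 ≤ i then e i.toNat else g^[(-i).toNat] (e 0)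
  have hd : ∀ i, d i ∈ H := fun i => by
    simp only [d]
    split_ifs
    · exact hw _
    · exact hiter _
  have hstep : ∀ i, (d i).2.2 = (d (i + 1)).1 := by
    intro i
    rcases lt_or_ge i 0 with hi | hi
    · obtain ⟨n, rfl⟩ : ∃ n : ℕ, i = -(n : ℤ) - 1 := ⟨(-i - 1).toNat, by omega⟩
      have h1 : d (-(n : ℤ) - 1) = g^[n + 1] (e 0) := by
        have : (-(-(n : ℤ) - 1)).toNat = n + 1 := by omega
        simp only [d, if_neg (not_le.2 hi), this]
      have h2 : d (-(n : ℤ) - 1 + 1) = g^[n] (e 0) := by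
        rcases n with _ | n
        · simp [d]
        · simp only [d]
          rw [if_neg (by push_cast; omega)]
          congr 2
      rw [h1, h2, Function.iterate_succ_apply']
      exact hg' _ (hiter n)
    · obtain ⟨n, rfl⟩ := Int.eq_ofNat_of_zero_le hi
      have h2 : (0 : ℤ) ≤ (n : ℤ) + 1 := by omega
      have h3 : ((n : ℤ) + 1).toNat = n + 1 := by omega
      simp [d, e, h2, h3]
  refine ⟨fun i => (d i).2.1, (hX _).2 ⟨fun i => (d i).1, fun i => ?_⟩, fun n => ?_⟩
  · simp only [← hstep]
    exact hd i
  · simp [d, e]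

/-- A run together with a presenting path is a path in the product graph. Requiring `e` to be an
edge leaves finitely many candidate starting vertices. -/
theorem IsPresentedBy.exists_accepts_iff {X : Set (ℤ → ℕ)} {H : List (ℕ × ℕ × ℕ)}
    (hX : IsPresentedBy X H) (M : MullerAutomaton) :
    (∃ x ∈ X, M.Accepts fun n : ℕ => x n) ↔ ∃ F ∈ M.table, ∃ e ∈ productEdges M.trans H,
      e.1.1 ∈ M.initial ∧ HasLimit (productEdges M.trans H) F e.1 := by
  constructor
  · rintro ⟨x, hx, r, hr0, hr, F, hF, hlim⟩
    obtain ⟨h, hh⟩ := (hX.1 x).1 hx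
    have hE : ∀ i : ℕ, ((r i, h i), (r (i + 1), h (i + 1 : ℕ))) ∈ productEdges M.trans H :=
      fun i => mem_productEdges.2 ⟨x i, hr i, by simpa using hh i⟩
    exact ⟨F, hF, _, hE 0, hr0, fun i => (r i, h i), rfl, hE, hlim⟩
  · rintro ⟨F, hF, e, -, he0, s, hs0, hs, hlim⟩
    choose w hw using fun i => mem_productEdges.1 (hs i)
    obtain ⟨x, hx, hxw⟩ := hX.exists_extension fun i => (hw i).2
    exact ⟨x, hx, fun i => (s i).1, by simpa [hs0] using he0,
      fun i => by simpa [hxw] using (hw i).1, F, hF, hlim⟩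

theorem frequently_intCast_atTop {p : ℤ → Prop} :
    (∃ᶠ i in atTop, p i) ↔ ∃ᶠ n : ℕ in atTop, p n := by
  simp only [frequently_atTop]
  constructor
  · intro h N
    obtain ⟨i, hi, hp⟩ := h N
    obtain ⟨n, rfl⟩ := Int.eq_ofNat_of_zero_le ((Int.natCast_nonneg N).trans hi)
    exact ⟨n, by simpa using hi, hp⟩
  · intro h a
    obtain ⟨n, hn, hp⟩ := h a.toNat
    exact ⟨n, by omega, hp⟩

theorem frequently_intCast_atBot {p : ℤ → Prop} :
    (∃ᶠ i in atBot, p i) ↔ ∃ᶠ n : ℕ in atTop, p (-n) := by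
  rw [← frequently_intCast_atTop (p := fun i => p (-i)), ← map_neg_atTop, frequently_map]

/-- A bi-infinite path is cut at time `0` into a forward path and a path in the reversed graph from
the same vertex, and each half has its own limit condition. -/
theorem IsPresentedBy.exists_bi_accepts_iff {X : Set (ℤ → ℕ)} {H : List (ℕ × ℕ × ℕ)}
    (hX : IsPresentedBy X H) (M : BiMullerAutomaton) :
    (∃ x ∈ X, M.Accepts x) ↔ ∃ F ∈ M.table, ∃ e ∈ productEdges M.trans H,
      HasLimit ((productEdges M.trans H).map Prod.swap) F.1 e.1 ∧
        HasLimit (productEdges M.trans H) F.2 e.1 := by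
  have hswap : ∀ (E : List ((ℕ × ℕ) × (ℕ × ℕ))) a b, (a, b) ∈ E.map Prod.swap ↔ (b, a) ∈ E := by
    intro E a b
    simp
  constructor
  · rintro ⟨x, hx, r, hr, F, hF, hL, hR⟩
    obtain ⟨h, hh⟩ := (hX.1 x).1 hx
    have hE : ∀ i : ℤ, ((r i, h i), (r (i + 1), h (i + 1))) ∈ productEdges M.trans H :=
      fun i => mem_productEdges.2 ⟨x i, hr i, hh i⟩
    simp only [frequently_intCast_atBot] at hL
    simp only [frequently_intCast_atTop] at hR
    refine ⟨F, hF, _, hE 0, ⟨fun n => (r (-n), h (-n)), by simp, fun n => ?_, hL⟩,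
      ⟨fun n => (r n, h n), rfl, fun n => by simpa using hE n, hR⟩⟩
    rw [hswap]
    have := hE (-(n + 1 : ℕ))
    rwa [show (-((n + 1 : ℕ) : ℤ) + 1) = -n by push_cast; ring] at this
  · rintro ⟨F, hF, e, -, ⟨s, hs0, hs, hL⟩, ⟨t, ht0, ht, hR⟩⟩
    simp only [hswap] at hs
    let r : ℤ → ℕ × ℕ := fun i => if 0 ≤ i then t i.toNat else s (-i).toNat
    have hrt : ∀ n : ℕ, r n = t n := fun n => by simp [r]
    have hrs : ∀ n : ℕ, r (-n) = s n := fun n => by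
      rcases n with _ | n
      · simp [r, hs0, ht0]
      · simp only [r]
        rw [if_neg (by push_cast; omega), neg_neg, Int.toNat_natCast]
    have hr : ∀ i, (r i, r (i + 1)) ∈ productEdges M.trans H := by
      intro i
      rcases lt_or_ge i 0 with hi | hi
      · obtain ⟨n, rfl⟩ : ∃ n : ℕ, i = -((n + 1 : ℕ) : ℤ) := ⟨(-i - 1).toNat, by omega⟩
        rw [show (-((n + 1 : ℕ) : ℤ) + 1) = -n by push_cast; ring, hrs, hrs]
        exact hs n
      · obtain ⟨n, rfl⟩ := Int.eq_ofNat_of_zero_le hi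
        have h1 : ((n : ℤ) + 1) = ((n + 1 : ℕ) : ℤ) := by push_cast; rfl
        rw [h1, hrt, hrt]
        exact ht n
    choose w hw using fun i => mem_productEdges.1 (hr i)
    refine ⟨w, (hX.1 w).2 ⟨fun i => (r i).2, fun i => (hw i).2⟩, fun i => (r i).1,
      fun i => (hw i).1, F, hF, ?_, ?_⟩
    · simpa only [frequently_intCast_atBot, hrs] using hL
    · simpa only [frequently_intCast_atTop, hrt] using hR

theorem IsPresentedBy.isMullerDecidable {X : Set (ℤ → ℕ)} {H : List (ℕ × ℕ × ℕ)}
    (hX : IsPresentedBy X H) : IsMullerDecidable X := by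
  refine ⟨ComputablePred.of_eq (PrimrecPred.computablePred ?_) fun M =>
      (hX.exists_accepts_iff M).symm, ComputablePred.of_eq (PrimrecPred.computablePred ?_) fun M =>
      (hX.exists_bi_accepts_iff M).symm⟩
  · have hM : Primrec MullerAutomaton.equivProd :=
      Primrec.of_equiv (e := MullerAutomaton.equivProd)
    have hinit : Primrec MullerAutomaton.initial := Primrec.fst.comp hM
    have htrans : Primrec MullerAutomaton.trans := Primrec.fst.comp (Primrec.snd.comp hM)
    have htable : Primrec MullerAutomaton.table := Primrec.snd.comp (Primrec.snd.comp hM)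
    have hE : Primrec fun M : MullerAutomaton => productEdges M.trans H :=
      (primrec_productEdges H).comp htrans
    have h1 : PrimrecRel fun (e : (ℕ × ℕ) × (ℕ × ℕ)) (b : List ℕ × MullerAutomaton) =>
        e.1.1 ∈ b.2.initial ∧ HasLimit (productEdges b.2.trans H) b.1 e.1 := by
      refine PrimrecPred.and ?_ ?_
      · exact primrecRel_mem_list.comp (Primrec.fst.comp (Primrec.fst.comp Primrec.fst))
          (hinit.comp (Primrec.snd.comp Primrec.snd))
      · exact primrecRel_hasLimit.comp (Primrec.pair (hE.comp (Primrec.snd.comp Primrec.snd))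
          (Primrec.fst.comp Primrec.snd)) (Primrec.fst.comp Primrec.fst)
    have h2 : PrimrecRel fun (F : List ℕ) (M : MullerAutomaton) =>
        ∃ e ∈ productEdges M.trans H,
          e.1.1 ∈ M.initial ∧ HasLimit (productEdges M.trans H) F e.1 :=
      h1.exists_mem_list.comp (hE.comp Primrec.snd) Primrec.id
    exact h2.exists_mem_list.comp htable Primrec.id
  · have hM : Primrec BiMullerAutomaton.equivProd :=
      Primrec.of_equiv (e := BiMullerAutomaton.equivProd)
    have htrans : Primrec BiMullerAutomaton.trans := Primrec.fst.comp hM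
    have htable : Primrec BiMullerAutomaton.table := Primrec.snd.comp hM
    have hE : Primrec fun M : BiMullerAutomaton => productEdges M.trans H :=
      (primrec_productEdges H).comp htrans
    have hE' : Primrec fun M : BiMullerAutomaton => (productEdges M.trans H).map Prod.swap :=
      Primrec.list_map hE (Primrec.pair (Primrec.snd.comp Primrec.snd)
        (Primrec.fst.comp Primrec.snd)).to₂
    have h1 : PrimrecRel fun (e : (ℕ × ℕ) × (ℕ × ℕ))
        (b : (List ℕ × List ℕ) × BiMullerAutomaton) =>
        HasLimit ((productEdges b.2.trans H).map Prod.swap) b.1.1 e.1 ∧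
          HasLimit (productEdges b.2.trans H) b.1.2 e.1 := by
      refine PrimrecPred.and ?_ ?_
      · exact primrecRel_hasLimit.comp (Primrec.pair (hE'.comp (Primrec.snd.comp Primrec.snd))
          (Primrec.fst.comp (Primrec.fst.comp Primrec.snd))) (Primrec.fst.comp Primrec.fst)
      · exact primrecRel_hasLimit.comp (Primrec.pair (hE.comp (Primrec.snd.comp Primrec.snd))
          (Primrec.snd.comp (Primrec.fst.comp Primrec.snd))) (Primrec.fst.comp Primrec.fst)
    have h2 : PrimrecRel fun (F : List ℕ × List ℕ) (M : BiMullerAutomaton) =>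
        ∃ e ∈ productEdges M.trans H,
          HasLimit ((productEdges M.trans H).map Prod.swap) F.1 e.1 ∧
            HasLimit (productEdges M.trans H) F.2 e.1 :=
      h1.exists_mem_list.comp (hE.comp Primrec.snd) Primrec.id
    exact h2.exists_mem_list.comp htable Primrec.id

end Presentation

/-! ### The two-cycle graph and its bi-infinite paths. -/

section WordGraph

/-- The edges of the graph formed by a cycle on `0, …, n - 1`, a path
`n - 1, n, …, n + m` and a cycle on `n + m, …, 2 * n + m - 1`. -/
def CycleStep (n m a b : ℕ) : Prop :=
  (a + 1 = b ∧ b < 2 * n + m) ∨ (a + 1 = n ∧ b = 0) ∨ (a + 1 = 2 * n + m ∧ b = n + m)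

/-- The bi-infinite path that moves from the first cycle to the second one. -/
def crossingPath (n m : ℕ) (i : ℤ) : ℕ :=
  if i < 0 then (i % n).toNat else if i < m then n + i.toNat else n + m + ((i - m) % n).toNat

theorem emod_succ_cases {n : ℕ} (hn : 0 < n) (i : ℤ) :
    ((i + 1) % n = i % n + 1 ∧ i % n + 1 < n) ∨ ((i + 1) % n = 0 ∧ i % n + 1 = n) := by
  have h0 : (0 : ℤ) < n := by exact_mod_cast hn
  have h1 := Int.emod_lt_of_pos i h0
  have h2 := Int.emod_nonneg i h0.ne'
  rcases (Int.add_one_le_of_lt h1).lt_or_eq with h | h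
  · refine Or.inl ⟨?_, h⟩
    rw [← Int.emod_add_emod]
    exact Int.emod_eq_of_lt (by omega) h
  · refine Or.inr ⟨?_, h⟩
    rw [← Int.emod_add_emod, h, Int.emod_self]

theorem cycleStep_left {n m : ℕ} (hn : 0 < n) (i : ℤ) :
    CycleStep n m (i % n).toNat ((i + 1) % n).toNat := by
  have h2 := Int.emod_nonneg i (b := n) (by omega)
  unfold CycleStep
  rcases emod_succ_cases hn i with h | h <;> omega

theorem cycleStep_right {n m : ℕ} (hn : 0 < n) (i : ℤ) :
    CycleStep n m (n + m + (i % n).toNat) (n + m + ((i + 1) % n).toNat) := by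
  have h2 := Int.emod_nonneg i (b := n) (by omega)
  unfold CycleStep
  rcases emod_succ_cases hn i with h | h <;> omega

theorem cycleStep_crossingPath {n m : ℕ} (hn : 0 < n) (i : ℤ) :
    CycleStep n m (crossingPath n m i) (crossingPath n m (i + 1)) := by
  unfold crossingPath
  rcases lt_trichotomy i (-1) with hi | rfl | hi
  · rw [if_pos (show i < 0 by omega), if_pos (show i + 1 < 0 by omega)]
    exact cycleStep_left hn i
  · have h1 : ((-1 : ℤ) % n) = n - 1 := by
      rw [Int.emod_eq_iff (by omega)]
      exact ⟨by omega, by omega, by simp⟩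
    unfold CycleStep
    rcases Nat.eq_zero_or_pos m with rfl | hm
    · simp [h1]
      omega
    · simp [h1, hm]
      omega
  · rw [if_neg (show ¬i < 0 by omega), if_neg (show ¬i + 1 < 0 by omega)]
    rcases lt_trichotomy (i + 1) m with h | h | h
    · rw [if_pos (show i < m by omega), if_pos h]
      unfold CycleStep
      omega
    · rw [if_pos (show i < m by omega), if_neg (show ¬i + 1 < m by omega)]
      have : i + 1 - m = 0 := by omega
      simp only [this, Int.zero_emod]
      unfold CycleStep
      omega
    · rw [if_neg (show ¬i < m by omega), if_neg (show ¬i + 1 < m by omega), add_sub_right_comm]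
      exact cycleStep_right hn _

/-- The only branching is at `n - 1`, where the first cycle can be left; beyond it the future is
forced. -/
theorem CycleStep.right_unique {n m a b b' : ℕ} (h : CycleStep n m a b) (h' : CycleStep n m a b')
    (ha : n ≤ a) : b = b' := by
  unfold CycleStep at h h'
  omega

/-- The first cycle cannot be entered from outside, so inside it the past is forced. -/
theorem CycleStep.left_unique {n m a a' b : ℕ} (h : CycleStep n m a b) (h' : CycleStep n m a' b)
    (hb : b < n) : a = a' := by
  unfold CycleStep at h h'
  omega

theorem eq_emod_of_cyclic {n : ℕ} (hn : 0 < n) {g : ℤ → ℕ} (hlt : ∀ i, g i < n)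
    (hg : ∀ i, g i + 1 = g (i + 1) ∨ (g i + 1 = n ∧ g (i + 1) = 0)) (i : ℤ) :
    g i = ((i + g 0) % n).toNat := by
  have hm : ∀ i : ℤ, (g i : ℤ) = (i + g 0) % n := by
    intro i
    induction i with
    | zero => rw [zero_add, Int.emod_eq_of_lt (by omega) (by exact_mod_cast hlt 0)]
    | succ i ih =>
      have h1 := hg i
      have h2 := hlt (i + 1)
      have h3 := emod_succ_cases hn (i + g 0)
      rw [add_right_comm]
      omega
    | pred i ih =>
      have h1 := hg (-i - 1)
      have h2 := hlt (-i - 1)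
      have h3 := emod_succ_cases hn (-i - 1 + g 0)
      have h4 := Int.emod_nonneg (-i - 1 + g 0 : ℤ) (b := n) (by omega)
      rw [show (-i - 1 + g 0 + 1 : ℤ) = -i + g 0 by ring] at h3
      rw [sub_add_cancel] at h1
      omega
  rw [← hm, Int.toNat_natCast]

/-- A path stays in the first cycle, avoids it, or leaves it exactly once. In the last case the time
of leaving determines the whole path, by forward and backward determinism. -/
theorem cycleStep_path_cases {n m : ℕ} (hn : 0 < n) {h : ℤ → ℕ}
    (hh : ∀ i, CycleStep n m (h i) (h (i + 1))) :
    (∃ k : ℤ, ∀ i, h i = crossingPath n m (k + i)) ∨ (∃ k : ℤ, ∀ i, h i = ((k + i) % n).toNat) ∨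
      ∃ k : ℤ, ∀ i, h i = n + m + ((k + i) % n).toNat := by
  have hlt : ∀ i, h i < 2 * n + m := fun i => by
    have := hh i
    unfold CycleStep at this
    omega
  by_cases h1 : ∀ i, h i < n
  · refine Or.inr (Or.inl ⟨h 0, fun i => ?_⟩)
    rw [add_comm]
    refine eq_emod_of_cyclic hn h1 (fun i => ?_) i
    have := hh i
    have := h1 i
    have := h1 (i + 1)
    unfold CycleStep at *
    omega
  by_cases h2 : ∀ i, n ≤ h i
  · have h3 : ∀ i, n + m ≤ h i := by
      intro i
      by_contra! hi
      -- On the connecting path each backward step lowers the vertex by one, which cannot continue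
      -- forever.
      have h4 : ∀ j : ℕ, h (i - j) + j = h i := by
        intro j
        induction j with
        | zero => simp
        | succ j ih =>
          have h5 := hh (i - (j + 1 : ℕ))
          have h6 := h2 (i - j)
          rw [show (i - (j + 1 : ℕ) + 1 : ℤ) = i - j by push_cast; ring] at h5
          unfold CycleStep at h5
          omega
      have := h4 (h i + 1)
      omega
    have h4 := eq_emod_of_cyclic (g := fun i => h i - (n + m)) hn
      (fun i => by have := hlt i; have := h3 i; omega) (fun i => by
        have h5 := hh i
        have h6 := h3 i
        have h7 := h3 (i + 1)
        unfold CycleStep at h5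
        omega)
    refine Or.inr (Or.inr ⟨(h 0 - (n + m) : ℕ), fun i => ?_⟩)
    have h5 := h4 i
    have h6 := h3 i
    rw [add_comm _ i]
    omega
  push Not at h1 h2
  obtain ⟨b, hb⟩ := h1
  obtain ⟨a, ha⟩ := h2
  obtain ⟨k, hk, hk'⟩ : ∃ k, h k < n ∧ n ≤ h (k + 1) := by
    by_contra! hcon
    have hup : ∀ i, a ≤ i → h i < n := fun i hi => by
      induction i, hi using Int.leInduction with
      | base => exact ha
      | succ i _ ih => exact hcon i ih
    have hdown : ∀ i, i ≤ a → h i < n := fun i hi => by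
      induction i, hi using Int.leInductionDown with
      | base => exact ha
      | pred i _ ih =>
        have := hh (i - 1)
        rw [sub_add_cancel] at this
        unfold CycleStep at this
        omega
    rcases le_total a b with hab | hab
    · exact absurd (hup b hab) (by omega)
    · exact absurd (hdown b hab) (by omega)
  -- `crossingPath` is at vertex `n` at time `0`, whereas `h` first reaches it at time `k + 1`.
  refine Or.inl ⟨-(k + 1), fun i => ?_⟩
  suffices hs : ∀ i, h (i + (k + 1)) = crossingPath n m i by
    have := hs (-(k + 1) + i)
    rwa [show -(k + 1) + i + (k + 1) = i by ring] at this
  have hc := cycleStep_crossingPath (n := n) (m := m) hn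
  have c0 : crossingPath n m 0 = n := by
    unfold crossingPath
    rcases Nat.eq_zero_or_pos m with rfl | hm
    · simp
    · simp [hm]
  have hkk := hh k
  have hge : ∀ i : ℕ, n ≤ crossingPath n m i := fun i => by
    unfold crossingPath
    split_ifs <;> omega
  have hnat : ∀ i : ℕ, h (i + (k + 1)) = crossingPath n m i := by
    intro i
    induction i with
    | zero =>
      rw [Nat.cast_zero, zero_add, c0]
      unfold CycleStep at hkk
      omega
    | succ i ih =>
      have h5 := hh (i + (k + 1))
      rw [ih] at h5
      have h6 := h5.right_unique (hc i) (hge i)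
      rw [Nat.cast_succ, ← h6]
      congr 1
      ring
  have hneg : ∀ i : ℕ, h (-(i + 1 : ℕ) + (k + 1)) = crossingPath n m (-(i + 1 : ℕ)) := by
    intro i
    induction i with
    | zero =>
      have h5 := hc (-1)
      have h7 : crossingPath n m (-1) < n := by
        have := Int.emod_lt_of_pos (-1) (b := n) (by omega)
        simp only [crossingPath]
        rw [if_pos (by omega)]
        omega
      rw [show (-1 + 1 : ℤ) = 0 by norm_num, c0] at h5
      have : (-((0 + 1 : ℕ) : ℤ) + (k + 1)) = k := by push_cast; ring
      rw [this]
      have : -((0 + 1 : ℕ) : ℤ) = -1 := by norm_num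
      rw [this]
      unfold CycleStep at h5 hkk
      omega
    | succ i ih =>
      have h5 := hh (-((i + 1 + 1 : ℕ) : ℤ) + (k + 1))
      have h6 := hc (-((i + 1 + 1 : ℕ) : ℤ))
      rw [show (-((i + 1 + 1 : ℕ) : ℤ) + (k + 1) + 1) = -((i + 1 : ℕ) : ℤ) + (k + 1) by
        push_cast; ring, ih] at h5
      rw [show (-((i + 1 + 1 : ℕ) : ℤ) + 1) = -((i + 1 : ℕ) : ℤ) by push_cast; ring] at h6
      refine h5.left_unique h6 ?_
      have := Int.emod_lt_of_pos (-((i + 1 : ℕ) : ℤ)) (b := n) (by omega)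
      simp only [crossingPath]
      rw [if_pos (by omega)]
      omega
  intro i
  rcases lt_or_ge i 0 with hi | hi
  · obtain ⟨j, rfl⟩ : ∃ j : ℕ, i = -((j + 1 : ℕ) : ℤ) := ⟨(-i - 1).toNat, by omega⟩
    exact hneg j
  · obtain ⟨j, rfl⟩ := Int.eq_ofNat_of_zero_le hi
    exact hnat j

/-- The labelled graph presenting the orbit closure of `… u u u v u u u …`. -/
def wordGraph (u v : List ℕ) : List (ℕ × ℕ × ℕ) :=
  (List.range (2 * u.length + v.length - 1)).map (fun k => (k, (u ++ v ++ u).getD k 0, k + 1)) ++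
    [(u.length - 1, (u ++ v ++ u).getD (u.length - 1) 0, 0),
      (2 * u.length + v.length - 1, (u ++ v ++ u).getD (2 * u.length + v.length - 1) 0,
        u.length + v.length)]

theorem mem_wordGraph {u v : List ℕ} (hu : u ≠ []) {a l b : ℕ} :
    (a, l, b) ∈ wordGraph u v ↔
      l = (u ++ v ++ u).getD a 0 ∧ CycleStep u.length v.length a b := by
  have hn := List.length_pos_iff.2 hu
  simp only [wordGraph, List.mem_append, List.mem_map, List.mem_range, Prod.mk.injEq,
    List.mem_cons, List.not_mem_nil, or_false, CycleStep]
  constructor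
  · rintro (⟨k, hk, rfl, rfl, rfl⟩ | ⟨rfl, rfl, rfl⟩ | ⟨rfl, rfl, rfl⟩) <;>
      refine ⟨rfl, ?_⟩ <;> omega
  · rintro ⟨rfl, ⟨rfl, h⟩ | ⟨h, rfl⟩ | ⟨h, rfl⟩⟩
    · exact Or.inl ⟨a, by omega, rfl, rfl, rfl⟩
    · obtain rfl : a = u.length - 1 := by omega
      exact Or.inr (Or.inl ⟨rfl, rfl, rfl⟩)
    · obtain rfl : a = 2 * u.length + v.length - 1 := by omega
      exact Or.inr (Or.inr ⟨rfl, rfl, rfl⟩)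

theorem getD_left {u v : List ℕ} (hu : u ≠ []) (i : ℤ) :
    (u ++ v ++ u).getD (i % (u.length : ℤ)).toNat 0 = u.getD (i % (u.length : ℤ)).toNat 0 := by
  have hn := List.length_pos_iff.2 hu
  have := Int.emod_lt_of_pos i (b := u.length) (by omega)
  rw [List.append_assoc, List.getD_append _ _ _ _ (by omega)]

theorem getD_right {u v : List ℕ} (j : ℕ) :
    (u ++ v ++ u).getD (u.length + v.length + j) 0 = u.getD j 0 := by
  rw [List.getD_append_right _ _ _ _ (by simp)]
  congr 1
  simp

theorem biPeriodicPoint_nil (u : List ℕ) (i : ℤ) :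
    biPeriodicPoint u [] u i = u.getD (i % (u.length : ℤ)).toNat 0 := by
  simp only [biPeriodicPoint, List.length_nil, Nat.cast_zero, sub_zero]
  split_ifs <;> rfl

theorem biPeriodicPoint_eq_getD {u v : List ℕ} (hu : u ≠ []) (i : ℤ) :
    biPeriodicPoint u v u i = (u ++ v ++ u).getD (crossingPath u.length v.length i) 0 := by
  unfold biPeriodicPoint crossingPath
  split_ifs with h1 h2
  · rw [getD_left hu]
  · rw [List.append_assoc, List.getD_append_right _ _ _ _ (by omega), Nat.add_sub_cancel_left,
      List.getD_append _ _ _ _ (by omega)]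
  · rw [getD_right]

/-- Both cycles carry the word `u`, so paths confined to either one give the same periodic orbit,
and crossing paths give the other orbit. -/
theorem isPresentedBy_wordGraph {u v : List ℕ} (hu : u ≠ []) :
    IsPresentedBy
      (Set.range (fun k : ℤ => SymbolicDynamics.FullShift.shift k (biPeriodicPoint u v u)) ∪
        Set.range fun k : ℤ => SymbolicDynamics.FullShift.shift k (biPeriodicPoint u [] u))
      (wordGraph u v) := by
  have hn := List.length_pos_iff.2 hu
  refine ⟨fun x => ?_, ?_⟩
  · simp only [mem_wordGraph hu, forall_and]
    constructor
    · rintro (⟨k, rfl⟩ | ⟨k, rfl⟩)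
      · refine ⟨fun i => crossingPath u.length v.length (k + i), fun i => ?_, fun i => ?_⟩
        · exact biPeriodicPoint_eq_getD hu _
        · simp only [← add_assoc]
          exact cycleStep_crossingPath hn _
      · refine ⟨fun i => ((k + i) % (u.length : ℤ)).toNat, fun i => ?_, fun i => ?_⟩
        · rw [getD_left hu]
          exact biPeriodicPoint_nil u _
        · simp only [← add_assoc]
          exact cycleStep_left hn _
    · rintro ⟨h, hx, hh⟩
      rcases cycleStep_path_cases hn hh with ⟨k, hk⟩ | ⟨k, hk⟩ | ⟨k, hk⟩
      · refine Or.inl ⟨k, funext fun i => ?_⟩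
        rw [hx, hk, ← biPeriodicPoint_eq_getD hu]
        rfl
      · refine Or.inr ⟨k, funext fun i => ?_⟩
        rw [hx, hk, getD_left hu, ← biPeriodicPoint_nil]
        rfl
      · refine Or.inr ⟨k, funext fun i => ?_⟩
        rw [hx, hk, getD_right, ← biPeriodicPoint_nil]
        rfl
  · rintro ⟨a, l, b⟩ h
    rw [mem_wordGraph hu] at h
    have ha : ∃ c, CycleStep u.length v.length c a := by
      have h2 := h.2
      unfold CycleStep at h2 ⊢
      rcases Nat.eq_zero_or_pos a with rfl | ha
      · exact ⟨u.length - 1, by omega⟩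
      · exact ⟨a - 1, by omega⟩
    obtain ⟨c, hc⟩ := ha
    exact ⟨_, (mem_wordGraph hu).2 ⟨rfl, hc⟩, rfl⟩

end WordGraph

/-! ### Isolated points and orbits in countable subshifts. -/

section Subshifts

open SymbolicDynamics.FullShift (shift)

theorem shift_shift (k l : ℤ) (x : ℤ → ℕ) : shift k (shift l x) = shift (k + l) x := by
  funext i
  change x (l + (k + i)) = x (k + l + i)
  congr 1
  ring

theorem zero_shift (x : ℤ → ℕ) : shift (0 : ℤ) x = x := by
  funext i
  change x (0 + i) = x i
  rw [zero_add]

theorem continuous_shift_int (k : ℤ) : Continuous (shift k : (ℤ → ℕ) → ℤ → ℕ) :=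
  continuous_pi fun i => continuous_apply (k + i)

theorem IsSubshift.shift_mem {X : Set (ℤ → ℕ)} (hX : IsSubshift X) {x : ℤ → ℕ} (hx : x ∈ X)
    (k : ℤ) : shift k x ∈ X := by
  induction k with
  | zero => rwa [zero_shift]
  | succ k ih =>
    rw [add_comm, ← shift_shift, ← hX.2]
    exact ⟨_, ih, rfl⟩
  | pred k ih =>
    rw [← hX.2] at ih
    obtain ⟨y, hy, he⟩ := ih
    have : shift (-k - 1 : ℤ) x = y := by
      rw [sub_eq_neg_add, ← shift_shift, ← he, shift_shift, neg_add_cancel, zero_shift]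
    rwa [this]

theorem isSubshift_of_shift_mem {X : Set (ℤ → ℕ)} (hX : IsCompact X)
    (h : ∀ x ∈ X, ∀ k : ℤ, shift k x ∈ X) : IsSubshift X := by
  refine ⟨hX, Set.Subset.antisymm ?_ fun x hx => ⟨_, h x hx (-1), ?_⟩⟩
  · rintro _ ⟨x, hx, rfl⟩
    exact h x hx 1
  · rw [shift_shift, add_neg_cancel, zero_shift]

theorem range_shift_shift (k : ℤ) (x : ℤ → ℕ) :
    (Set.range fun l : ℤ => shift l (shift k x)) = Set.range fun l : ℤ => shift l x := by
  simp only [shift_shift]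
  exact (Equiv.addRight k).surjective.range_comp fun l : ℤ => shift l x

theorem mem_orbitClosure (x : ℤ → ℕ) : x ∈ orbitClosure x :=
  subset_closure ⟨0, zero_shift x⟩

theorem IsSubshift.orbitClosure_subset {X : Set (ℤ → ℕ)} (hX : IsSubshift X) {x : ℤ → ℕ}
    (hx : x ∈ X) : orbitClosure x ⊆ X :=
  closure_minimal (Set.range_subset_iff.2 (hX.shift_mem hx)) hX.1.isClosed

theorem IsSubshift.isSubshift_orbitClosure {X : Set (ℤ → ℕ)} (hX : IsSubshift X) {x : ℤ → ℕ}
    (hx : x ∈ X) : IsSubshift (orbitClosure x) := by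
  refine isSubshift_of_shift_mem
    (hX.1.of_isClosed_subset isClosed_closure (hX.orbitClosure_subset hx)) fun y hy k => ?_
  have h := image_closure_subset_closure_image (continuous_shift_int k)
    (Set.mem_image_of_mem _ hy)
  refine closure_mono ?_ h
  rintro _ ⟨_, ⟨l, rfl⟩, rfl⟩
  exact ⟨k + l, (shift_shift k l x).symm⟩

/-- Otherwise `∅`, `Y`, `Z`, `X` would be four distinct subshifts. -/
theorem eq_of_subsystemCount_le {X Y Z : Set (ℤ → ℕ)} (hX : IsSubshift X)
    (h3 : subsystemCount X ≤ 3) (hY : IsSubshift Y) (hYX : Y ⊂ X) (hY0 : Y.Nonempty)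
    (hZ : IsSubshift Z) (hZX : Z ⊂ X) (hZ0 : Z.Nonempty) : Y = Z := by
  by_contra hYZ
  have hempty : IsSubshift ∅ := ⟨isCompact_empty, Set.image_empty _⟩
  have hsub : ({∅, Y, Z, X} : Set (Set (ℤ → ℕ))) ⊆ {Y | IsSubshift Y ∧ Y ⊆ X} := by
    rintro W (rfl | rfl | rfl | rfl)
    exacts [⟨hempty, Set.empty_subset _⟩, ⟨hY, hYX.1⟩, ⟨hZ, hZX.1⟩, ⟨hX, subset_rfl⟩]
  have hX0 : X.Nonempty := hY0.mono hYX.1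
  have hcard : ({∅, Y, Z, X} : Set (Set (ℤ → ℕ))).encard = 4 := by
    rw [Set.encard_insert_of_notMem, Set.encard_insert_of_notMem, Set.encard_pair hZX.ne]
    · norm_num
    · simp [hYZ, hYX.ne]
    · simp [hY0.ne_empty.symm, hZ0.ne_empty.symm, hX0.ne_empty.symm]
  have := (Set.encard_le_encard hsub).trans h3
  rw [hcard] at this
  exact absurd this (by decide)

/-- `x` is an isolated point of `X`. -/
def IsIsolatedIn (X : Set (ℤ → ℕ)) (x : ℤ → ℕ) : Prop :=
  ∃ U, IsOpen U ∧ X ∩ U = {x}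

theorem IsIsolatedIn.mem {X : Set (ℤ → ℕ)} {x : ℤ → ℕ} (h : IsIsolatedIn X x) : x ∈ X := by
  obtain ⟨U, -, hU⟩ := h
  exact (hU.symm.subset rfl).1

/-- Baire: `X` is a countable union of closed singletons, so one of them has interior. -/
theorem IsCompact.exists_isIsolatedIn {X : Set (ℤ → ℕ)} (hX : IsCompact X) (hc : X.Countable)
    (h0 : X.Nonempty) : ∃ x, IsIsolatedIn X x := by
  have := hc.to_subtype
  have := h0.to_subtype
  have := isCompact_iff_compactSpace.1 hX
  obtain ⟨x, hx⟩ := nonempty_interior_of_iUnion_of_closed (X := X) (f := fun x => {x})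
    (fun _ => isClosed_singleton) (Set.iUnion_of_singleton X)
  have hopen : IsOpen ({x} : Set X) := by
    rw [← interior_eq_iff_isOpen]
    exact (Set.Nonempty.subset_singleton_iff hx).1 interior_subset
  obtain ⟨U, hU, he⟩ := isOpen_induced_iff.1 hopen
  refine ⟨x, U, hU, ?_⟩
  rw [← Subtype.image_preimage_coe, he, Set.image_singleton]

theorem IsIsolatedIn.shift_point {X : Set (ℤ → ℕ)} (hX : IsSubshift X) {x : ℤ → ℕ}
    (h : IsIsolatedIn X x) (k : ℤ) : IsIsolatedIn X (shift k x) := by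
  obtain ⟨U, hU, he⟩ := h
  refine ⟨_, hU.preimage (continuous_shift_int (-k)), ?_⟩
  have hxU : x ∈ X ∩ U := he.symm.subset rfl
  ext y
  simp only [Set.mem_inter_iff, Set.mem_preimage, Set.mem_singleton_iff]
  constructor
  · rintro ⟨hy, hyU⟩
    have : shift (-k) y = x := he.subset ⟨hX.shift_mem hy _, hyU⟩
    rw [← this, shift_shift, add_neg_cancel, zero_shift]
  · rintro rfl
    rw [shift_shift, neg_add_cancel, zero_shift]
    exact ⟨hX.shift_mem hxU.1 _, hxU.2⟩

theorem IsSubshift.diff_orbit {X : Set (ℤ → ℕ)} (hX : IsSubshift X) {x : ℤ → ℕ}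
    (h : IsIsolatedIn X x) : IsSubshift (X \ Set.range fun k : ℤ => shift k x) := by
  choose U hU he using fun k => h.shift_point hX k
  have hd : X \ (Set.range fun k : ℤ => shift k x) = X \ ⋃ k, U k := by
    ext y
    refine and_congr_right fun hy => not_congr ?_
    simp only [Set.mem_range, Set.mem_iUnion]
    refine exists_congr fun k => ⟨?_, fun hk => ((he k).subset ⟨hy, hk⟩).symm⟩
    rintro rfl
    exact ((he k).symm.subset rfl).2
  refine isSubshift_of_shift_mem ?_ ?_
  · rw [hd]
    exact hX.1.diff (isOpen_iUnion hU)
  · rintro y ⟨hy, hn⟩ k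
    refine ⟨hX.shift_mem hy k, ?_⟩
    rintro ⟨l, hl⟩
    refine hn ⟨-k + l, ?_⟩
    simp only at hl
    simp only [← shift_shift, hl]
    rw [shift_shift, neg_add_cancel, zero_shift]

/-- Every point of `K` is isolated in `X`, and a compact discrete set is finite. -/
theorem IsSubshift.finite_of_subset_orbit {X K : Set (ℤ → ℕ)} (hX : IsSubshift X) {x : ℤ → ℕ}
    (h : IsIsolatedIn X x) (hK : IsCompact K) (hKX : K ⊆ X)
    (hKx : K ⊆ Set.range fun k : ℤ => shift k x) : K.Finite := by
  have hiso : ∀ y ∈ K, IsIsolatedIn X y := by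
    intro y hy
    obtain ⟨k, rfl⟩ := hKx hy
    exact h.shift_point hX k
  choose! U hU he using hiso
  obtain ⟨t, ht, hKt⟩ := hK.elim_nhds_subcover U fun y hy =>
    (hU y hy).mem_nhds ((he y hy).symm.subset rfl).2
  refine t.finite_toSet.subset fun y hy => ?_
  obtain ⟨z, hz, hyz⟩ := Set.mem_iUnion₂.1 (hKt hy)
  have : y = z := (he z (ht z hz)).subset ⟨hKX hy, hyz⟩
  rwa [this]

theorem exists_period_of_not_injective {x : ℤ → ℕ}
    (h : ¬Function.Injective fun k : ℤ => shift k x) :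
    ∃ n : ℕ, 0 < n ∧ Function.Periodic x n := by
  have key : ∀ k l : ℤ, k < l → shift k x = shift l x →
      ∃ n : ℕ, 0 < n ∧ Function.Periodic x n := by
    intro k l hkl he
    refine ⟨(l - k).toNat, by omega, fun i => ?_⟩
    have := congrFun he (i - k)
    change x (k + (i - k)) = x (l + (i - k)) at this
    rw [show k + (i - k) = i by ring] at this
    rw [this]
    congr 1
    omega
  simp only [Function.Injective] at h
  push Not at h
  obtain ⟨k, l, he, hne⟩ := h
  rcases hne.lt_or_gt with hkl | hkl
  · exact key k l hkl he
  · exact key l k hkl he.symm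

theorem finite_orbit_of_periodic {x : ℤ → ℕ} {n : ℕ} (hn : 0 < n) (h : Function.Periodic x n) :
    (Set.range fun k : ℤ => shift k x).Finite := by
  refine ((Set.finite_Ico (0 : ℤ) n).image fun k => shift k x).subset ?_
  rintro _ ⟨k, rfl⟩
  refine ⟨k % n, ⟨Int.emod_nonneg _ (by omega), Int.emod_lt_of_pos _ (by omega)⟩, ?_⟩
  funext i
  change x (k % n + i) = x (k + i)
  rw [← h.int_mul (k / n) (k % n + i)]
  congr 1
  have := Int.emod_add_mul_ediv k n
  simp only [Int.cast_id]
  linarith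

theorem IsSubshift.exists_period {X : Set (ℤ → ℕ)} (hX : IsSubshift X) {x : ℤ → ℕ}
    (h : IsIsolatedIn X x) (hXx : X ⊆ Set.range fun k : ℤ => shift k x) :
    ∃ n : ℕ, 0 < n ∧ Function.Periodic x n := by
  refine exists_period_of_not_injective fun hinj => ?_
  have hfin := hX.finite_of_subset_orbit h hX.1 subset_rfl hXx
  have h1 := hfin.subset (Set.range_subset_iff.2 (hX.shift_mem h.mem))
  exact Set.infinite_range_of_injective hinj h1

end Subshifts

/-! ### From periodic windows to periodic tails. -/

section EventuallyPeriodic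

open SymbolicDynamics.FullShift (shift)

theorem getD_ofFn_periodic {z : ℤ → ℕ} {n : ℕ} (hn : 0 < n) (hz : Function.Periodic z n)
    (i : ℤ) : (List.ofFn fun j : Fin n => z (j : ℕ)).getD (i % n).toNat 0 = z i := by
  have h1 := Int.emod_lt_of_pos i (b := n) (by omega)
  have h2 := Int.emod_nonneg i (b := n) (by omega)
  have h3 : (i % n).toNat < n := by omega
  rw [List.getD_eq_getElem _ _ (by simpa using h3), List.getElem_ofFn]
  rw [← hz.int_mul (i / n)]
  congr 1
  have := Int.emod_add_mul_ediv i n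
  simp only [Int.cast_id, Int.toNat_of_nonneg h2]
  linarith

theorem eq_biPeriodicPoint {y z : ℤ → ℕ} {n m : ℕ} (hn : 0 < n) (hz : Function.Periodic z n)
    (hl : ∀ i < 0, y i = z i) (hr : ∀ i : ℤ, m ≤ i → y i = z (i - m)) :
    y = biPeriodicPoint (List.ofFn fun j : Fin n => z (j : ℕ)) (List.ofFn fun j : Fin m => y (j : ℕ))
      (List.ofFn fun j : Fin n => z (j : ℕ)) := by
  funext i
  simp only [biPeriodicPoint, List.length_ofFn, getD_ofFn_periodic hn hz]
  split_ifs with h1 h2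
  · exact hl i h1
  · have h3 : i.toNat < m := by omega
    rw [List.getD_eq_getElem _ _ (by simpa using h3), List.getElem_ofFn]
    simp only [Int.toNat_of_nonneg (not_lt.1 h1)]
  · exact hr i (not_lt.1 h2)

/-- The points that look like a shift of `z` on the coordinates `0, …, n`. -/
def windowNhd (z : ℤ → ℕ) (n : ℕ) : Set (ℤ → ℕ) :=
  ⋃ j : ℤ, ⋂ i ∈ Finset.Icc (0 : ℤ) n, {y | y i = z (j + i)}

theorem isOpen_windowNhd (z : ℤ → ℕ) (n : ℕ) : IsOpen (windowNhd z n) :=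
  isOpen_iUnion fun j => isOpen_biInter_finset fun i _ =>
    isOpen_discrete (α := ℕ) {z (j + i)} |>.preimage (continuous_apply (A := fun _ : ℤ => ℕ) i)

theorem shift_mem_windowNhd (z : ℤ → ℕ) (n : ℕ) (k : ℤ) : shift k z ∈ windowNhd z n := by
  simp only [windowNhd, Set.mem_iUnion, Set.mem_iInter]
  exact ⟨k, fun i _ => rfl⟩

theorem mem_windowNhd {z x : ℤ → ℕ} {n : ℕ} {k : ℤ} (h : shift k x ∈ windowNhd z n) :
    ∃ j : ℤ, ∀ i : ℤ, 0 ≤ i → i ≤ n → x (k + i) = z (j + i) := by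
  simp only [windowNhd, Set.mem_iUnion, Set.mem_iInter, Finset.mem_Icc] at h
  obtain ⟨j, hj⟩ := h
  exact ⟨j, fun i h0 h1 => hj i ⟨h0, h1⟩⟩

/-- A window has `n + 1` letters, one more than the period of `z`, so a matching window at `k`
forces `x (k + n) = x k`. One matching window on each side then propagates outwards; the phases `a`
and `b` may differ. -/
theorem exists_tails {z x : ℤ → ℕ} {n : ℕ} (hn : 0 < n) (hz : Function.Periodic z n)
    (hfin : {k : ℤ | shift k x ∉ windowNhd z n}.Finite) :
    ∃ N : ℕ, ∃ a b : ℤ, (∀ i : ℤ, i ≤ -N → x i = z (i + a)) ∧ ∀ i : ℤ, N ≤ i → x i = z (i + b) := by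
  obtain ⟨N, hN⟩ : ∃ N : ℕ, ∀ k : ℤ, N ≤ |k| → shift k x ∈ windowNhd z n := by
    obtain ⟨B, hB⟩ := (hfin.image Int.natAbs).bddAbove
    refine ⟨B + 1, fun k hk => ?_⟩
    by_contra hcon
    have := hB ⟨k, hcon, rfl⟩
    rw [Int.abs_eq_natAbs] at hk
    omega
  have hper : ∀ k : ℤ, N ≤ |k| → x (k + n) = x k := by
    intro k hk
    obtain ⟨j, hj⟩ := mem_windowNhd (hN k hk)
    have h0 := hj 0 le_rfl (by omega)
    rw [add_zero, add_zero] at h0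
    rw [hj n (by omega) le_rfl, h0, hz]
  obtain ⟨j, hj⟩ := mem_windowNhd (hN N (by simp))
  obtain ⟨l, hl⟩ := mem_windowNhd (hN (-N - n) (by rw [abs_of_nonpos] <;> omega))
  have hr : ∀ t : ℕ, x (N + t) = z (j + t) := by
    intro t
    induction t using Nat.strong_induction_on with
    | _ t ih =>
      rcases le_or_gt t n with ht | ht
      · exact hj t (by omega) (by omega)
      · obtain ⟨s, rfl⟩ := Nat.exists_eq_add_of_lt ht
        have h1 := ih (s + 1) (by omega)
        have h2 := hper (N + (s + 1 : ℕ)) (by rw [abs_of_nonneg] <;> omega)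
        have h3 := hz (j + (s + 1 : ℕ))
        rw [show (N + (n + s + 1 : ℕ) : ℤ) = N + (s + 1 : ℕ) + n by push_cast; ring, h2, h1, ← h3]
        congr 1
        push_cast
        ring
  have hleft : ∀ t : ℕ, x (-N - t) = z (l + n - t) := by
    intro t
    induction t using Nat.strong_induction_on with
    | _ t ih =>
      rcases le_or_gt t n with ht | ht
      · have := hl (n - t) (by omega) (by omega)
        rw [show (-N - n + (n - t) : ℤ) = -N - t by ring] at this
        rw [this]
        congr 1
        ring
      · obtain ⟨s, rfl⟩ := Nat.exists_eq_add_of_lt ht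
        have h1 := ih (s + 1) (by omega)
        have h2 := hper (-N - (n + s + 1 : ℕ)) (by rw [abs_of_nonpos] <;> omega)
        have h3 := hz (l + n - (n + s + 1 : ℕ))
        rw [← h2, ← h3, show (-N - (n + s + 1 : ℕ) + n : ℤ) = -N - (s + 1 : ℕ) by push_cast; ring, h1]
        congr 1
        push_cast
        ring
  refine ⟨N, l + n + N, j - N, fun i hi => ?_, fun i hi => ?_⟩
  · have := hleft (-N - i).toNat
    rw [show (-N - ((-N - i).toNat : ℤ)) = i by omega] at this
    rw [this]
    congr 1
    omega
  · have := hr (i - N).toNat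
    rw [show (N + ((i - N).toNat : ℤ)) = i by omega] at this
    rw [this]
    congr 1
    omega

theorem exists_shift_eq_biPeriodicPoint {z x : ℤ → ℕ} {n : ℕ} (hn : 0 < n)
    (hz : Function.Periodic z n) (hfin : {k : ℤ | shift k x ∉ windowNhd z n}.Finite) :
    ∃ (s : ℤ) (v : List ℕ), shift s x =
      biPeriodicPoint (List.ofFn fun j : Fin n => z (j : ℕ)) v
        (List.ofFn fun j : Fin n => z (j : ℕ)) := by
  obtain ⟨N, a, b, hl, hr⟩ := exists_tails hn hz hfin
  have hn' : (1 : ℤ) ≤ n := by exact_mod_cast hn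
  have hmul : ∀ t : ℤ, 0 ≤ t → t ≤ t * n := fun t ht => le_mul_of_one_le_right ht hn'
  -- Modulo `n`, `s` cancels the left phase `a`, and `m` makes the right tail start at phase zero.
  -- The added multiples of `n` ensure `s ≤ -N`, `0 ≤ m` and `N ≤ s + m`.
  obtain ⟨s, hs⟩ : ∃ s : ℤ, s = -a - (|a| + N) * n := ⟨_, rfl⟩
  obtain ⟨m, hm⟩ : ∃ m : ℤ, m = -s - b + (|s| + |b| + N) * n := ⟨_, rfl⟩
  have h1 := hmul (|a| + N) (by positivity)
  have h2 := hmul (|s| + |b| + N) (by positivity)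
  have h3 := neg_abs_le a
  have h4 := le_abs_self s
  have h5 := le_abs_self b
  have h6 := abs_nonneg s
  have hsN : s ≤ -N := by linarith
  have hm0 : 0 ≤ m := by linarith
  have hmN : (N : ℤ) ≤ s + m := by linarith
  lift m to ℕ using hm0
  refine ⟨s, _, eq_biPeriodicPoint (m := m) hn hz (fun i hi => ?_) fun i hi => ?_⟩
  · change x (s + i) = z i
    rw [hl _ (by omega), ← hz.int_mul (|a| + N)]
    congr 1
    simp only [Int.cast_id]
    linarith
  · change x (s + i) = z (i - m)
    rw [hr _ (by omega), ← hz.int_mul (|s| + |b| + N) (i - m)]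
    congr 1
    simp only [Int.cast_id]
    linarith

/-- A nonempty countable subshift with at most three subsystems consists of the orbit of
`… u u u v u u u …` and the orbit of `… u u u …`. -/
theorem IsSubshift.exists_eq_orbitClosure {X : Set (ℤ → ℕ)} (hX : IsSubshift X)
    (hc : X.Countable) (h3 : subsystemCount X ≤ 3) (h0 : X.Nonempty) :
    ∃ u v : List ℕ, u ≠ [] ∧ X = orbitClosure (biPeriodicPoint u v u) ∧
      X = (Set.range fun k : ℤ => shift k (biPeriodicPoint u v u)) ∪
        Set.range fun k : ℤ => shift k (biPeriodicPoint u [] u) := by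
  have hne : ∀ {n : ℕ} {f : Fin n → ℕ}, 0 < n → List.ofFn f ≠ [] := fun hn h => by
    simp [List.ofFn_eq_nil_iff] at h
    omega
  have hpt : ∀ {z : ℤ → ℕ} {n : ℕ}, 0 < n → Function.Periodic z n →
      z = biPeriodicPoint (List.ofFn fun j : Fin n => z (j : ℕ)) []
        (List.ofFn fun j : Fin n => z (j : ℕ)) := fun hn hz =>
    eq_biPeriodicPoint (m := 0) hn hz (fun _ _ => rfl) (by simp)
  obtain ⟨x, hx⟩ := hX.1.exists_isIsolatedIn hc h0
  obtain ⟨Z, hZ⟩ : ∃ Z, Z = X \ Set.range fun k : ℤ => shift k x := ⟨_, rfl⟩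
  have hZs : IsSubshift Z := hZ ▸ hX.diff_orbit hx
  rcases Z.eq_empty_or_nonempty with hZ0 | hZ0
  · rw [hZ0, eq_comm, Set.sdiff_eq_empty] at hZ
    obtain ⟨n, hn, hxn⟩ := hX.exists_period hx hZ
    have hXe := hZ.antisymm (Set.range_subset_iff.2 (hX.shift_mem hx.mem))
    refine ⟨List.ofFn fun j : Fin n => x (j : ℕ), [], hne hn, ?_, ?_⟩
    · rw [← hpt hn hxn]
      exact (hZ.trans subset_closure).antisymm (hX.orbitClosure_subset hx.mem)
    · rw [← hpt hn hxn, Set.union_self]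
      exact hXe
  · have hxZ : ∀ k : ℤ, shift k x ∉ Z := fun k h => by
      rw [hZ] at h
      exact h.2 ⟨k, rfl⟩
    have hZX : Z ⊂ X := by
      refine ⟨hZ ▸ Set.sdiff_subset, fun h => ?_⟩
      exact hxZ 0 (h (hX.shift_mem hx.mem 0))
    -- A proper orbit closure would have to be `Z`, which misses the orbit of `x`.
    have hclosure : ∀ k : ℤ, X = orbitClosure (shift k x) := by
      intro k
      by_contra hcon
      have hmem := hX.shift_mem hx.mem k
      have := eq_of_subsystemCount_le hX h3 hZs hZX hZ0 (hX.isSubshift_orbitClosure hmem)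
        (LE.le.ssubset_of_ne (hX.orbitClosure_subset hmem) (Ne.symm hcon))
        ⟨_, mem_orbitClosure _⟩
      exact hxZ k (this ▸ mem_orbitClosure _)
    obtain ⟨z, hz⟩ := hZs.1.exists_isIsolatedIn (hc.mono hZX.1) hZ0
    -- If nonempty, `Z` minus the orbit of `z` would again have to be `Z`, yet it omits `z`.
    have hZz : Z = Set.range fun k : ℤ => shift k z := by
      refine Set.Subset.antisymm ?_ (Set.range_subset_iff.2 (hZs.shift_mem hz.mem))
      rw [← Set.sdiff_eq_empty]
      by_contra hcon
      have hd := hZs.diff_orbit hz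
      have := eq_of_subsystemCount_le hX h3 hd
        (Set.sdiff_subset.trans_ssubset hZX) (Set.nonempty_iff_ne_empty.2 hcon) hZs hZX hZ0
      have hzd := this.symm ▸ hz.mem
      exact hzd.2 ⟨0, zero_shift z⟩
    obtain ⟨n, hn, hzn⟩ := hZs.exists_period hz hZz.subset
    have hXe : X = (Set.range fun k : ℤ => shift k x) ∪ Z := by
      rw [hZ, Set.union_sdiff_cancel (Set.range_subset_iff.2 (hX.shift_mem hx.mem))]
    -- A periodic `x` has a finite, hence closed, orbit; it would be all of `X` and contain `z`.
    have hinj : Function.Injective fun k : ℤ => shift k x := by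
      by_contra hcon
      obtain ⟨p, hp, hxp⟩ := exists_period_of_not_injective hcon
      have hcl := (finite_orbit_of_periodic hp hxp).isClosed.closure_eq
      have hzX := hZX.1 hz.mem
      rw [hclosure 0, zero_shift, orbitClosure, hcl] at hzX
      obtain ⟨k, rfl⟩ := hzX
      exact hxZ k hz.mem
    have hfin : {k : ℤ | shift k x ∉ windowNhd z n}.Finite := by
      -- The window neighbourhood contains `Z`, so its complement in `X` is a compact part of the
      -- orbit of `x`.
      have hK : (X \ windowNhd z n).Finite := by
        refine hX.finite_of_subset_orbit hx (hX.1.diff (isOpen_windowNhd z n)) Set.sdiff_subset ?_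
        rintro y ⟨hy, hyn⟩
        rw [hXe] at hy
        refine hy.resolve_right fun hyZ => hyn ?_
        rw [hZz] at hyZ
        obtain ⟨k, rfl⟩ := hyZ
        exact shift_mem_windowNhd z n k
      exact (hK.preimage hinj.injOn).subset fun k hk => ⟨hX.shift_mem hx.mem k, hk⟩
    obtain ⟨s, v, hv⟩ := exists_shift_eq_biPeriodicPoint hn hzn hfin
    refine ⟨List.ofFn fun j : Fin n => z (j : ℕ), v, hne hn, ?_, ?_⟩
    · rw [← hv]
      exact hclosure s
    · rw [← hv, ← hpt hn hzn, range_shift_shift, ← hZz]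
      exact hXe

end EventuallyPeriodic

theorem isPresentedBy_empty : IsPresentedBy ∅ [] :=
  ⟨fun x => by simp, by simp⟩

theorem mainTheorem11 (X : Set (ℤ → ℕ)) (hX : IsSubshift X) (hc : X.Countable)
    (h3 : subsystemCount X ≤ 3) :
    (X.Nonempty → ∃ u v : List ℕ, u ≠ [] ∧ X = orbitClosure (biPeriodicPoint u v u)) ∧
      IsMullerDecidable X := by
  refine ⟨fun h0 => ?_, ?_⟩
  · obtain ⟨u, v, hu, h, -⟩ := hX.exists_eq_orbitClosure hc h3 h0
    exact ⟨u, v, hu, h⟩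
  · rcases X.eq_empty_or_nonempty with rfl | h0
    · exact isPresentedBy_empty.isMullerDecidable
    · obtain ⟨u, v, hu, -, h⟩ := hX.exists_eq_orbitClosure hc h3 h0
      rw [h]
      exact (isPresentedBy_wordGraph hu).isMullerDecidable
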